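/- All vector lattices are real and Archimedean, and all operators are linear. Let $Y$ and $Z$ be vector lattices, let $T\colon Y\to Z$ be an order bounded operator (it maps order intervals into order intervals), and let $X$ be a (vector) sublattice of $Y$ such that - $X$ is majorizing in $Y$: for every $y\in Y_+$ there exists $x\in X$ with $y\le x$; - $X$ is uniformly dense in $Y$: the only uniformly closed subset of $Y$ containing $X$ is $Y$ itself. Here $y_n\to y$ uniformly if there exists $e\in Y_+$ such that for every $\varepsilon>0$ one has $|y_n-y|\le\varepsilon e$ for all sufficiently large $n$, and a subset of $Y$ is uniformly closed if it contains the limits of all uniformly convergent sequences of its elements. Then each of the following properties holds for $T$ if and only if it holds for the restriction $T|_X\colon X\to Z$: 1. positivity; 2. order continuity ($x_\alpha\to x$ in order implies $Tx_\alpha\to Tx$ in order, for all nets; here $x_\alpha\to x$ in order means that there is a net $u_\gamma\downarrow 0$, possibly over another index set, such that for every $\gamma$ one has $|x_\alpha-x|\le u_\gamma$ for all sufficiently large $\alpha$; for $T|_X$, order convergence in the domain is that of the vector lattice $X$); 3. being disjointness preserving ($|x|\wedge|y|=0$ implies $|Tx|\wedge|Ty|=0$); 4. being injective and disjointness preserving.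 The same is true for every combination of these properties, and for the property of being a lattice homomorphism. -/

import Mathlib

/-- A real vector lattice (given by the instances on `E`) is Archimedean if `0` is the only positive
vector `x` whose multiples `n x` are all dominated by one vector. -/
def IsArchimedeanLattice (E : Type*) [Lattice E] [AddCommGroup E] : Prop :=
  ∀ x y : E, 0 ≤ x → (∀ n : ℕ, n • x ≤ y) → x = 0

/-- A (vector) sublattice of a vector lattice: a linear subspace closed under `⊔` and `⊓`. -/
structure VectorSublattice (E : Type*) [Lattice E] [AddCommGroup E] [Module ℝ E] extends
  Submodule ℝ E, Sublattice E

namespace VectorSublattice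

section

variable {E : Type*} [Lattice E] [AddCommGroup E] [Module ℝ E]

instance : SetLike (VectorSublattice E) E where
  coe X := X.carrier
  coe_injective X X' h := by
    cases X with
    | mk S hs hi =>
      cases X' with
      | mk S' hs' hi' =>
        have : S = S' := SetLike.coe_injective h
        subst this
        rfl

instance : AddSubgroupClass (VectorSublattice E) E where
  add_mem {X} _ _ ha hb := X.toSubmodule.add_mem ha hb
  zero_mem X := X.toSubmodule.zero_mem
  neg_mem {X} _ ha := X.toSubmodule.neg_mem ha

instance : SMulMemClass (VectorSublattice E) ℝ E where
  smul_mem {X} r _ ha := X.toSubmodule.smul_mem r ha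

variable (X : VectorSublattice E)

/-- A sublattice carries the lattice operations and the order of the ambient space. -/
instance : Lattice X :=
  Subtype.lattice (fun _ _ ha hb => X.supClosed' ha hb) (fun _ _ ha hb => X.infClosed' ha hb)

/-- The inclusion of a sublattice. -/
def inclusion : X →ₗ[ℝ] E where
  toFun x := x
  map_add' _ _ := rfl
  map_smul' _ _ := rfl

instance [IsOrderedAddMonoid E] : IsOrderedAddMonoid X where
  add_le_add_left _ _ h c := add_le_add_left (α := E) h c

instance [IsOrderedModule ℝ E] : IsOrderedModule ℝ X where
  smul_le_smul_of_nonneg_left _ hr _ _ h := smul_le_smul_of_nonneg_left (β := E) h hr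
  smul_le_smul_of_nonneg_right _ hx _ _ h := smul_le_smul_of_nonneg_right (β := E) h hx

end

end VectorSublattice

section Convergence

variable {E : Type*} [Lattice E] [AddCommGroup E]

/-- The net `x` converges to `a` uniformly relative to the regulator `e`. -/
def UniformConvergesRel [Module ℝ E] {Λ : Type*} [Preorder Λ] (x : Λ → E) (a e : E) : Prop :=
  ∀ ε : ℝ, 0 < ε → ∃ i₀ : Λ, ∀ i, i₀ ≤ i → |x i - a| ≤ ε • e

/-- The net `x` converges to `a` (relatively) uniformly. -/
def UniformConverges [Module ℝ E] {Λ : Type*} [Preorder Λ] (x : Λ → E) (a : E) : Prop :=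
  ∃ e : E, 0 ≤ e ∧ UniformConvergesRel x a e

/-- A set is uniformly closed if it contains the limits of all uniformly convergent sequences
of its elements. -/
def IsUniformlyClosed [Module ℝ E] (C : Set E) : Prop :=
  ∀ (x : ℕ → E) (a : E), (∀ n, x n ∈ C) → UniformConverges x a → a ∈ C

/-- The uniform closure: the intersection of all uniformly closed sets containing `A`. -/
def uniformClosure [Module ℝ E] (A : Set E) : Set E :=
  ⋂₀ {C : Set E | IsUniformlyClosed C ∧ A ⊆ C}

/-- The net `x` order converges to `a`: there is a net `u ↓ 0` (its index set need not be that
of `x`) such that for each `γ` eventually `|x i - a| ≤ u γ`. Only the set `D` of the values of `u`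
matters: the value sets of nets decreasing to `0` are precisely the non-empty downward directed
sets with infimum `0`. -/
def OrderConverges {Λ : Type*} [Preorder Λ] (x : Λ → E) (a : E) : Prop :=
  ∃ D : Set E, D.Nonempty ∧ DirectedOn (· ≥ ·) D ∧ IsGLB D 0 ∧
    ∀ d ∈ D, ∃ i₀ : Λ, ∀ i, i₀ ≤ i → |x i - a| ≤ d

end Convergence

/-- A sublattice `X` is majorizing if every positive vector lies below an element of `X`. -/
def VectorSublattice.IsMajorizing {E : Type*} [Lattice E] [AddCommGroup E] [Module ℝ E]
    (X : VectorSublattice E) : Prop :=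
  ∀ y : E, 0 ≤ y → ∃ x ∈ X, y ≤ x

/-- A sublattice is uniformly dense if its uniform closure is the whole space. -/
def VectorSublattice.IsUniformlyDense {E : Type*} [Lattice E] [AddCommGroup E] [Module ℝ E]
    (X : VectorSublattice E) : Prop :=
  uniformClosure (X : Set E) = Set.univ

namespace LinearMap

section

universe u v

variable {E : Type u} {F : Type v} [Lattice E] [AddCommGroup E] [Module ℝ E]
  [Lattice F] [AddCommGroup F] [Module ℝ F]

/-- `T` maps order bounded sets to order bounded sets. -/
def IsOrderBounded (T : E →ₗ[ℝ] F) : Prop :=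
  ∀ a b : E, ∃ c d : F, ∀ x ∈ Set.Icc a b, T x ∈ Set.Icc c d

/-- `T` maps positive vectors to positive vectors. -/
def IsPositiveOperator (T : E →ₗ[ℝ] F) : Prop :=
  ∀ x : E, 0 ≤ x → 0 ≤ T x

/-- `T` maps order convergent nets to order convergent nets, preserving the limit. (Nets indexed by
the universe of `E` suffice: every filter on `E` is the tail filter of such a net.) -/
def IsOrderContinuous (T : E →ₗ[ℝ] F) : Prop :=
  ∀ (Λ : Type u) [Preorder Λ] [IsDirectedOrder Λ] [Nonempty Λ] (x : Λ → E) (a : E),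
    OrderConverges x a → OrderConverges (fun i => T (x i)) (T a)

/-- `T` maps disjoint vectors to disjoint vectors. -/
def IsDisjointnessPreserving (T : E →ₗ[ℝ] F) : Prop :=
  ∀ x y : E, |x| ⊓ |y| = 0 → |T x| ⊓ |T y| = 0

/-- `T` preserves the lattice operations. -/
def IsLatticeHomomorphism (T : E →ₗ[ℝ] F) : Prop :=
  ∀ x y : E, T (x ⊔ y) = T x ⊔ T y ∧ T (x ⊓ y) = T x ⊓ T y

end

end LinearMap

/-- The four properties of operators under consideration. -/
inductive OperatorProperty where
  | positive
  | orderContinuous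
  | disjointnessPreserving
  | injectiveDisjointnessPreserving

/-- The operator `T` has the given property. -/
def OperatorProperty.Holds {E F : Type*} [Lattice E] [AddCommGroup E] [Module ℝ E]
    [Lattice F] [AddCommGroup F] [Module ℝ F] (T : E →ₗ[ℝ] F) : OperatorProperty → Prop
  | positive => T.IsPositiveOperator
  | orderContinuous => T.IsOrderContinuous
  | disjointnessPreserving => T.IsDisjointnessPreserving
  | injectiveDisjointnessPreserving => Function.Injective T ∧ T.IsDisjointnessPreserving

/-! An order bounded `T` satisfies `|T a - T b| ≤ ε • f` whenever `|a - b| ≤ ε • e`, with `f`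
depending only on `e`; lattice operations behave likewise. As `Z` is Archimedean, an inequality `φ y
≤ w` built from such maps cuts out a uniformly closed set (`isUniformlyClosed_setOf_le`), so it
passes from `X` to `Y`. Positivity, disjointness preservation and the homomorphism property become
such inequalities in one variable, stated through `y ⊔ 0` and `-y ⊔ 0`.

Injectivity and order continuity also need `le_of_forall_le`: each `y` is the supremum of the
elements of `X` below it. Thus `X` is order dense, and a nonzero kernel, being an ideal
(`map_eq_zero_of_le`), would meet `X` nontrivially. Infima equal to `0` also pass between `X` and
`Y`, and truncation to `[-d, d]` with `d ∈ X` carries bounds on `T` from `X` to `Y`. -/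

/-! ### Disjointness and positive parts -/

section LatticeGroup

variable {E : Type*} [Lattice E] [AddCommGroup E] [IsOrderedAddMonoid E]

theorem inf_add_le_inf_add_inf {a b c : E} (ha : 0 ≤ a) (hb : 0 ≤ b) (hc : 0 ≤ c) :
    (a + b) ⊓ c ≤ a ⊓ c + b ⊓ c := by
  rw [add_inf, inf_add, inf_add]
  refine le_inf (le_inf inf_le_left ?_) (le_inf ?_ ?_)
  · exact inf_le_right.trans (le_add_of_nonneg_right hb)
  · exact inf_le_right.trans (le_add_of_nonneg_left ha)
  · exact inf_le_right.trans (le_add_of_nonneg_left hc)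

theorem abs_sub_inf_eq_zero {a b c : E} (ha : |a| ⊓ |c| = 0) (hb : |b| ⊓ |c| = 0) :
    |a - b| ⊓ |c| = 0 := by
  refine le_antisymm ?_ (le_inf (abs_nonneg _) (abs_nonneg _))
  calc |a - b| ⊓ |c| ≤ (|a| + |b|) ⊓ |c| := inf_le_inf_right _ (by
        rw [sub_eq_add_neg, ← abs_neg b]; exact abs_add_le a (-b))
    _ ≤ |a| ⊓ |c| + |b| ⊓ |c| :=
        inf_add_le_inf_add_inf (abs_nonneg _) (abs_nonneg _) (abs_nonneg _)
    _ = 0 := by rw [ha, hb, add_zero]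

/-- `|b|` lies below both `|a + b| + |a|` and `|a + b| + |b|`, whose meet is `|a + b| + |a| ⊓ |b|`.
-/
theorem abs_le_abs_add_of_disjoint {a b : E} (h : |a| ⊓ |b| = 0) : |b| ≤ |a + b| := by
  have h1 : |b| ≤ |a + b| + |a| := by
    have := abs_add_le (a + b) (-a)
    rwa [abs_neg, add_neg_cancel_comm] at this
  have h2 : |b| ≤ |a + b| + |b| := le_add_of_nonneg_left (abs_nonneg _)
  have h3 := le_inf h1 h2
  rwa [← add_inf, h, add_zero] at h3

theorem abs_sup_zero_sub_sup_zero_le (a b : E) : |a ⊔ 0 - b ⊔ 0| ≤ |a - b| :=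
  abs_sup_sub_sup_le_abs a b 0

theorem sup_zero_sub_neg_sup_zero (a : E) : a ⊔ 0 - (-a) ⊔ 0 = a := by
  simpa [posPart_def, negPart_def] using posPart_sub_negPart a

theorem sup_zero_inf_neg_sup_zero (a : E) : (a ⊔ 0) ⊓ (-a ⊔ 0) = 0 := by
  simpa [posPart_def, negPart_def] using posPart_inf_negPart_eq_zero a

theorem sub_sup_zero_eq_of_inf_eq_zero {a b : E} (h : a ⊓ b = 0) : (a - b) ⊔ 0 = a := by
  have h1 : a ⊔ b = a + b := by
    have := inf_add_sup a b
    rwa [h, zero_add] at this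
  calc (a - b) ⊔ 0 = a ⊔ b - b := by
        rw [sub_eq_add_neg, sub_eq_add_neg, sup_add, add_neg_cancel]
    _ = a := by rw [h1, add_sub_cancel_right]

end LatticeGroup

/-! ### The Archimedean property -/

section VectorLattice

variable {E : Type*} [Lattice E] [AddCommGroup E] [Module ℝ E] [IsOrderedModule ℝ E]

theorem le_smul_abs_of_le_smul {ε : ℝ} (hε : 0 < ε) {x e : E} (h : x ≤ ε • e) : x ≤ ε • |e| :=
  h.trans (smul_le_smul_of_nonneg_left (le_abs_self e) hε.le)

variable [IsOrderedAddMonoid E]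

/-- In an Archimedean vector lattice, a vector dominated by all `ε • e` is not positive. -/
theorem IsArchimedeanLattice.nonpos_of_forall_le_smul (hE : IsArchimedeanLattice E) {z e : E}
    (h : ∀ ε : ℝ, 0 < ε → z ≤ ε • e) : z ≤ 0 := by
  have key : z ⊔ 0 = 0 := by
    refine hE (z ⊔ 0) |e| le_sup_right fun n => ?_
    rcases Nat.eq_zero_or_pos n with rfl | hn
    · simp
    · have hn' : (0 : ℝ) < n := by exact_mod_cast hn
      have h1 : z ⊔ 0 ≤ (n : ℝ)⁻¹ • |e| :=
        sup_le (le_smul_abs_of_le_smul (inv_pos.2 hn') (h _ (inv_pos.2 hn')))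
          (smul_nonneg (inv_pos.2 hn').le (abs_nonneg e))
      have h2 := smul_le_smul_of_nonneg_left h1 hn'.le
      rwa [smul_smul, mul_inv_cancel₀ hn'.ne', one_smul, Nat.cast_smul_eq_nsmul] at h2
  exact le_sup_left.trans key.le

end VectorLattice

/-! ### Maps compatible with uniform convergence -/

section RegulatorContinuity

variable {E F G : Type*} [Lattice E] [AddCommGroup E] [Module ℝ E] [Lattice F] [AddCommGroup F]
  [Module ℝ F] [Lattice G] [AddCommGroup G] [Module ℝ G]

/-- A map is regulator Lipschitz if every regulator `e` of the domain has a regulator `f` of the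
codomain such that `|a - b| ≤ ε • e` implies `|φ a - φ b| ≤ ε • f`. -/
def IsRegulatorLipschitz (φ : E → F) : Prop :=
  ∀ e : E, ∃ f : F, ∀ ε : ℝ, 0 < ε → ∀ a b : E, |a - b| ≤ ε • e → |φ a - φ b| ≤ ε • f

theorem IsRegulatorLipschitz.comp {ψ : F → G} {φ : E → F} (hψ : IsRegulatorLipschitz ψ)
    (hφ : IsRegulatorLipschitz φ) : IsRegulatorLipschitz (fun x => ψ (φ x)) := by
  intro e
  obtain ⟨f, hf⟩ := hφ e
  obtain ⟨g, hg⟩ := hψ f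
  exact ⟨g, fun ε hε a b h => hg ε hε _ _ (hf ε hε a b h)⟩

theorem IsRegulatorLipschitz.of_abs_sub_le {φ : E → E} (h : ∀ a b, |φ a - φ b| ≤ |a - b|) :
    IsRegulatorLipschitz φ :=
  fun e => ⟨e, fun _ _ a b hab => (h a b).trans hab⟩

theorem isRegulatorLipschitz_neg : IsRegulatorLipschitz (fun x : E => -x) :=
  .of_abs_sub_le fun a b => by rw [neg_sub_neg, abs_sub_comm]

section

variable [IsOrderedAddMonoid E]

theorem isRegulatorLipschitz_sup_const (c : E) : IsRegulatorLipschitz (fun x : E => x ⊔ c) :=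
  .of_abs_sub_le fun a b => abs_sup_sub_sup_le_abs a b c

theorem isRegulatorLipschitz_inf_const (c : E) : IsRegulatorLipschitz (fun x : E => x ⊓ c) :=
  .of_abs_sub_le fun a b => abs_inf_sub_inf_le_abs a b c

theorem isRegulatorLipschitz_abs : IsRegulatorLipschitz (fun x : E => |x|) :=
  .of_abs_sub_le fun a b => abs_abs_sub_abs_le a b

end

variable [IsOrderedAddMonoid F]

theorem IsRegulatorLipschitz.sub {φ ψ : E → F} (hφ : IsRegulatorLipschitz φ)
    (hψ : IsRegulatorLipschitz ψ) : IsRegulatorLipschitz (fun x => φ x - ψ x) := by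
  intro e
  obtain ⟨f, hf⟩ := hφ e
  obtain ⟨g, hg⟩ := hψ e
  refine ⟨f + g, fun ε hε a b h => ?_⟩
  have h1 : φ a - ψ a - (φ b - ψ b) = (φ a - φ b) + -(ψ a - ψ b) := by abel
  rw [h1, smul_add]
  refine (abs_add_le _ _).trans (add_le_add (hf ε hε a b h) ?_)
  rw [abs_neg]
  exact hg ε hε a b h

theorem IsRegulatorLipschitz.inf {φ ψ : E → F} (hφ : IsRegulatorLipschitz φ)
    (hψ : IsRegulatorLipschitz ψ) : IsRegulatorLipschitz (fun x => φ x ⊓ ψ x) := by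
  intro e
  obtain ⟨f, hf⟩ := hφ e
  obtain ⟨g, hg⟩ := hψ e
  refine ⟨f + g, fun ε hε a b h => ?_⟩
  have h1 : φ a ⊓ ψ a - φ b ⊓ ψ b
      = (φ a ⊓ ψ a - φ b ⊓ ψ a) + (ψ a ⊓ φ b - ψ b ⊓ φ b) := by
    rw [inf_comm (ψ a), inf_comm (ψ b)]; abel
  rw [h1, smul_add]
  exact (abs_add_le _ _).trans (add_le_add
    ((abs_inf_sub_inf_le_abs _ _ _).trans (hf ε hε a b h))
    ((abs_inf_sub_inf_le_abs _ _ _).trans (hg ε hε a b h)))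

variable [IsOrderedModule ℝ F]

/-- The excess of `φ a` over `w` is at most `ε • f` for every `ε`, with `f` fixed, so the
Archimedean property removes it. -/
theorem IsRegulatorLipschitz.isUniformlyClosed_setOf_le (hF : IsArchimedeanLattice F)
    {φ : E → F} (hφ : IsRegulatorLipschitz φ) (w : F) : IsUniformlyClosed {y | φ y ≤ w} := by
  rintro x a hx ⟨e, -, hxa⟩
  obtain ⟨f, hf⟩ := hφ e
  refine sub_nonpos.1 (hF.nonpos_of_forall_le_smul (e := f) fun ε hε => ?_)
  obtain ⟨n, hn⟩ := hxa ε hε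
  have h1 := hf ε hε _ _ (hn n le_rfl)
  calc φ a - w ≤ φ a - φ (x n) := sub_le_sub_left (hx n) _
    _ ≤ |φ (x n) - φ a| := by rw [abs_sub_comm]; exact le_abs_self _
    _ ≤ ε • f := h1

variable [IsOrderedAddMonoid E] [IsOrderedModule ℝ E]

theorem LinearMap.IsOrderBounded.exists_abs_le_smul {T : E →ₗ[ℝ] F} (hT : T.IsOrderBounded)
    (e : E) : ∃ f : F, ∀ ε : ℝ, 0 < ε → ∀ w : E, |w| ≤ ε • e → |T w| ≤ ε • f := by
  obtain ⟨c, d, h⟩ := hT (-e) e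
  -- Scaling by `ε⁻¹` moves `w` into `[-e, e]`, whose image lies in `[c, d]`.
  refine ⟨-c ⊔ d, fun ε hε w hw => ?_⟩
  obtain ⟨hw1, hw2⟩ := abs_le'.1 hw
  have hε' : 0 ≤ ε⁻¹ := (inv_pos.2 hε).le
  have h1 : ε⁻¹ • w ≤ e := by
    have := smul_le_smul_of_nonneg_left hw1 hε'
    rwa [smul_smul, inv_mul_cancel₀ hε.ne', one_smul] at this
  have h2 : -(ε⁻¹ • w) ≤ e := by
    have := smul_le_smul_of_nonneg_left hw2 hε'
    rwa [smul_smul, inv_mul_cancel₀ hε.ne', one_smul, smul_neg] at this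
  obtain ⟨h3, h4⟩ := h (ε⁻¹ • w) ⟨neg_le.1 h2, h1⟩
  have h5 : ε • T (ε⁻¹ • w) = T w := by
    rw [map_smul, smul_smul, mul_inv_cancel₀ hε.ne', one_smul]
  rw [← h5]
  refine abs_le'.2 ⟨smul_le_smul_of_nonneg_left (h4.trans le_sup_right) hε.le, ?_⟩
  rw [← smul_neg]
  exact smul_le_smul_of_nonneg_left ((neg_le_neg h3).trans le_sup_left) hε.le

theorem LinearMap.IsOrderBounded.isRegulatorLipschitz {T : E →ₗ[ℝ] F} (hT : T.IsOrderBounded) :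
    IsRegulatorLipschitz T := by
  intro e
  obtain ⟨f, hf⟩ := hT.exists_abs_le_smul e
  exact ⟨f, fun ε hε a b h => by rw [← map_sub]; exact hf ε hε _ h⟩

end RegulatorContinuity

/-! ### Majorizing and uniformly dense sublattices -/

namespace VectorSublattice

variable {E : Type*} [Lattice E] [AddCommGroup E] [Module ℝ E] {X : VectorSublattice E}

theorem IsUniformlyDense.induction (hX : X.IsUniformlyDense) {P : E → Prop}
    (hP : IsUniformlyClosed {y | P y}) (h : ∀ x ∈ X, P x) (y : E) : P y := by
  have hy : y ∈ uniformClosure (X : Set E) := by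
    rw [show uniformClosure (X : Set E) = Set.univ from hX]; trivial
  exact hy {y | P y} ⟨hP, h⟩

theorem sup_mem {x y : E} (hx : x ∈ X) (hy : y ∈ X) : x ⊔ y ∈ X := X.supClosed' hx hy

variable [IsOrderedAddMonoid E] [IsOrderedModule ℝ E]

/-- Every vector is the supremum of the vectors of a majorizing, uniformly dense sublattice that
lie below it. -/
theorem IsUniformlyDense.le_of_forall_le (hE : IsArchimedeanLattice E) (hX : X.IsUniformlyDense)
    (hmaj : X.IsMajorizing) (y z : E) (hz : ∀ x ∈ X, x ≤ y → x ≤ z) : y ≤ z := by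
  revert z
  -- The bound `z` stays universally quantified because the hypothesis on `s n` is used with `z + ε
  -- • e'`. Choosing `e'` in `X` keeps `x - ε • e'` in `X`.
  refine hX.induction (P := fun y => ∀ z, (∀ x ∈ X, x ≤ y → x ≤ z) → y ≤ z) ?_
    (fun x hx z hz => hz x hx le_rfl) y
  rintro s a hs ⟨e, he, hsa⟩ z hz
  obtain ⟨e', he'X, hee'⟩ := hmaj e he
  refine sub_nonpos.1 (hE.nonpos_of_forall_le_smul (e := e' + e') fun ε hε => ?_)
  obtain ⟨n, hn⟩ := hsa ε hε
  obtain ⟨h1, h2⟩ := abs_le'.1 ((hn n le_rfl).trans (smul_le_smul_of_nonneg_left hee' hε.le))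
  have h3 : s n ≤ z + ε • e' := hs n _ fun x hx hxs => by
    refine sub_le_iff_le_add.1 (hz _ (sub_mem hx (SMulMemClass.smul_mem ε he'X)) ?_)
    exact sub_le_iff_le_add'.2 (hxs.trans (sub_le_iff_le_add.1 h1))
  rw [neg_sub] at h2
  have h4 : a ≤ ε • e' + (z + ε • e') := (sub_le_iff_le_add.1 h2).trans (by gcongr)
  rw [smul_add, sub_le_iff_le_add]
  exact h4.trans (le_of_eq (by abel))

theorem IsUniformlyDense.le_of_forall_ge (hE : IsArchimedeanLattice E) (hX : X.IsUniformlyDense)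
    (hmaj : X.IsMajorizing) (y z : E) (hz : ∀ x ∈ X, y ≤ x → z ≤ x) : z ≤ y := by
  refine neg_le_neg_iff.1 (hX.le_of_forall_le hE hmaj (-y) (-z) fun x hx hxy => ?_)
  exact le_neg.1 (hz (-x) (neg_mem hx) (le_neg.1 hxy))

/-- A majorizing, uniformly dense sublattice is order dense. -/
theorem IsUniformlyDense.nonpos_of_forall_eq_zero (hE : IsArchimedeanLattice E)
    (hX : X.IsUniformlyDense) (hmaj : X.IsMajorizing) {y : E} (hy : 0 ≤ y)
    (h : ∀ x ∈ X, 0 ≤ x → x ≤ y → x = 0) : y ≤ 0 :=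
  hX.le_of_forall_le hE hmaj y 0 fun x hx hxy =>
    le_sup_left.trans (h (x ⊔ 0) (sup_mem hx (zero_mem X)) le_sup_right (sup_le hxy hy)).le

end VectorSublattice

/-- The vectors dominated by elements of `D`, each with a chosen bound; smaller bounds come later. -/
structure DominatedPair {E : Type*} [Lattice E] [AddCommGroup E] (D : Set E) where
  /-- The bound. -/
  bound : E
  /-- The dominated vector. -/
  vec : E
  bound_mem : bound ∈ D
  abs_vec_le : |vec| ≤ bound

instance {E : Type*} [Lattice E] [AddCommGroup E] (D : Set E) : Preorder (DominatedPair D) :=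
  Preorder.lift fun p => OrderDual.toDual p.bound

/-! ### Transfer of the properties between `X` and `Y` -/

namespace LinearMap

universe u v

variable {E : Type u} {F : Type v} [Lattice E] [AddCommGroup E] [IsOrderedAddMonoid E]
  [Module ℝ E] [Lattice F] [AddCommGroup F] [IsOrderedAddMonoid F] [Module ℝ F] {T : E →ₗ[ℝ] F}
  {X : VectorSublattice E}

/-- It suffices to test preservation of disjointness on positive and negative parts. -/
theorem isDisjointnessPreserving_of_sup_zero
    (h : ∀ y : E, |T (y ⊔ 0)| ⊓ |T (-y ⊔ 0)| = 0) : T.IsDisjointnessPreserving := by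
  -- Disjoint `a` and `b` are the positive and negative parts of `a - b`.
  have pos : ∀ a b : E, a ⊓ b = 0 → |T a| ⊓ |T b| = 0 := by
    intro a b hab
    have h1 := h (a - b)
    rwa [neg_sub, sub_sup_zero_eq_of_inf_eq_zero hab,
      sub_sup_zero_eq_of_inf_eq_zero (by rwa [inf_comm])] at h1
  intro x y hxy
  have le : ∀ {a b : E}, 0 ≤ a → 0 ≤ b → a ≤ |x| → b ≤ |y| → a ⊓ b = 0 := fun ha hb hax hby =>
    le_antisymm ((inf_le_inf hax hby).trans hxy.le) (le_inf ha hb)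
  have hp : ∀ z : E, z ⊔ 0 ≤ |z| := fun z => sup_le (le_abs_self z) (abs_nonneg z)
  have hn : ∀ z : E, -z ⊔ 0 ≤ |z| := fun z => sup_le (neg_le_abs z) (abs_nonneg z)
  have key : ∀ b : E, 0 ≤ b → b ≤ |y| → |T x| ⊓ |T b| = 0 := by
    intro b hb hby
    rw [← sup_zero_sub_neg_sup_zero x, map_sub]
    exact abs_sub_inf_eq_zero (pos _ _ (le le_sup_right hb (hp x) hby))
      (pos _ _ (le le_sup_right hb (hn x) hby))
  rw [inf_comm, ← sup_zero_sub_neg_sup_zero y, map_sub]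
  refine abs_sub_inf_eq_zero ?_ ?_
  · rw [inf_comm]; exact key _ le_sup_right (hp y)
  · rw [inf_comm]; exact key _ le_sup_right (hn y)

variable [IsOrderedModule ℝ E] [IsOrderedModule ℝ F]

/-- The kernel of an order bounded disjointness preserving operator is an ideal. -/
theorem IsDisjointnessPreserving.map_eq_zero_of_le (hF : IsArchimedeanLattice F)
    (hT : T.IsOrderBounded) (hd : T.IsDisjointnessPreserving) {x y : E} (hx : 0 ≤ x)
    (hxy : x ≤ y) (hy : T y = 0) : T x = 0 := by
  obtain ⟨f, hf⟩ := hT.exists_abs_le_smul y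
  have hy0 : 0 ≤ y := hx.trans hxy
  have bound : ∀ n : ℕ, n • |T x| ≤ |f| := by
    intro n
    rcases Nat.eq_zero_or_pos n with rfl | hn
    · simp
    have hn' : (0 : ℝ) < n := by exact_mod_cast hn
    set ε : ℝ := (n : ℝ)⁻¹ with hεdef
    have hε : 0 < ε := inv_pos.2 hn'
    -- A discrete continuity argument: as `T y = 0`, each `k` splits `T x` into the disjoint parts
    -- `T (u k)` and `T x - T (u k)`. The second starts at `0`, ends at `T x`, and changes by at
    -- most `ε • |f|` per step; disjointness keeps it below `ε • |f|` throughout.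
    let u : ℕ → E := fun k => (x - ((k : ℝ) * ε) • y) ⊔ 0
    have hdisj : ∀ k, |T (u k)| ⊓ |T x - T (u k)| = 0 := by
      intro k
      have h1 : T x - T (u k) = -T (-(x - ((k : ℝ) * ε) • y) ⊔ 0) := by
        have h2 := congrArg T (sup_zero_sub_neg_sup_zero (x - ((k : ℝ) * ε) • y))
        rw [map_sub, map_sub, map_smul, hy, smul_zero, sub_zero] at h2
        rw [← h2]
        simp only [u]
        abel
      rw [h1, abs_neg]
      refine hd _ _ ?_
      rw [abs_of_nonneg le_sup_right, abs_of_nonneg le_sup_right]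
      exact sup_zero_inf_neg_sup_zero _
    have hstep : ∀ k, |T (u k) - T (u (k + 1))| ≤ ε • |f| := by
      intro k
      rw [← map_sub]
      refine le_smul_abs_of_le_smul hε (hf ε hε _ ?_)
      refine (abs_sup_zero_sub_sup_zero_le _ _).trans (le_of_eq ?_)
      have h1 : x - ((k : ℝ) * ε) • y - (x - (((k + 1 : ℕ) : ℝ) * ε) • y) = ε • y := by
        push_cast
        rw [add_mul, one_mul, add_smul]
        abel
      rw [h1, abs_of_nonneg (smul_nonneg hε.le hy0)]
    have hind : ∀ k, |T x - T (u k)| ≤ ε • |f| := by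
      intro k
      induction k with
      | zero =>
        have h1 : u 0 = x := by simp [u, hx]
        rw [h1, sub_self, abs_zero]
        exact smul_nonneg hε.le (abs_nonneg f)
      | succ k ih =>
        have h1 : |T x - T (u (k + 1))| ≤ |T x - T (u k)| + ε • |f| := by
          have h2 : T x - T (u (k + 1)) = (T x - T (u k)) + (T (u k) - T (u (k + 1))) := by abel
          rw [h2]
          exact (abs_add_le _ _).trans (by gcongr; exact hstep k)
        have h2 : |T x - T (u (k + 1))| ≤ |T x - T (u k)| + |T (u k)| := by
          refine (abs_le_abs_add_of_disjoint (hdisj (k + 1))).trans ?_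
          rw [add_sub_cancel]
          have h3 := abs_add_le (T x - T (u k)) (T (u k))
          rwa [sub_add_cancel] at h3
        have h3 := le_inf h1 h2
        rw [← add_inf] at h3
        refine h3.trans ?_
        -- Disjointness turns the sum into a supremum, so the errors do not accumulate.
        have h4 : |T x - T (u k)| ⊓ (ε • |f| ⊓ |T (u k)|) = 0 := by
          refine le_antisymm ?_ (le_inf (abs_nonneg _)
            (le_inf (smul_nonneg hε.le (abs_nonneg f)) (abs_nonneg _)))
          rw [← hdisj k, inf_comm |T (u k)|]
          exact inf_le_inf_left _ inf_le_right
        rw [← inf_add_sup, h4, zero_add]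
        exact sup_le ih inf_le_left
    have hlast : u n = 0 := by
      simp only [u]
      rw [hεdef, mul_inv_cancel₀ hn'.ne', one_smul]
      exact sup_eq_right.2 (sub_nonpos.2 hxy)
    have h1 := hind n
    rw [hlast, map_zero, sub_zero] at h1
    have h2 := smul_le_smul_of_nonneg_left h1 hn'.le
    rwa [smul_smul, hεdef, mul_inv_cancel₀ hn'.ne', one_smul, Nat.cast_smul_eq_nsmul] at h2
  have h0 := hF _ _ (abs_nonneg (T x)) bound
  exact le_antisymm ((le_abs_self _).trans h0.le) (neg_nonpos.1 ((neg_le_abs _).trans h0.le))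

theorem isPositiveOperator_iff_comp_inclusion (hF : IsArchimedeanLattice F)
    (hT : T.IsOrderBounded) (hX : X.IsUniformlyDense) :
    T.IsPositiveOperator ↔ (T ∘ₗ X.inclusion).IsPositiveOperator := by
  refine ⟨fun h x hx => h x hx, fun h y hy => ?_⟩
  have key : ∀ y : E, -T (y ⊔ 0) ≤ 0 := by
    refine hX.induction (IsRegulatorLipschitz.isUniformlyClosed_setOf_le hF
      (isRegulatorLipschitz_neg.comp
        (hT.isRegulatorLipschitz.comp (isRegulatorLipschitz_sup_const 0))) 0) fun x hx => ?_
    exact neg_nonpos.2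
      (h ⟨x ⊔ 0, VectorSublattice.sup_mem hx (zero_mem X)⟩ (le_sup_right (a := x)))
  have h1 := neg_nonpos.1 (key y)
  rwa [sup_eq_left.2 hy] at h1

theorem isDisjointnessPreserving_iff_comp_inclusion (hF : IsArchimedeanLattice F)
    (hT : T.IsOrderBounded) (hX : X.IsUniformlyDense) :
    T.IsDisjointnessPreserving ↔ (T ∘ₗ X.inclusion).IsDisjointnessPreserving := by
  refine ⟨fun h x y hxy => h x y (congrArg Subtype.val hxy), fun h => ?_⟩
  refine isDisjointnessPreserving_of_sup_zero fun y =>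
    le_antisymm ?_ (le_inf (abs_nonneg _) (abs_nonneg _))
  have h1 := hT.isRegulatorLipschitz.comp (isRegulatorLipschitz_sup_const 0)
  refine hX.induction (P := fun y => |T (y ⊔ 0)| ⊓ |T (-y ⊔ 0)| ≤ 0)
    (IsRegulatorLipschitz.isUniformlyClosed_setOf_le hF
      ((isRegulatorLipschitz_abs.comp h1).inf
        (isRegulatorLipschitz_abs.comp (h1.comp isRegulatorLipschitz_neg))) 0) (fun x hx => ?_) y
  refine (h ⟨x ⊔ 0, VectorSublattice.sup_mem hx (zero_mem X)⟩
    ⟨-x ⊔ 0, VectorSublattice.sup_mem (neg_mem hx) (zero_mem X)⟩ (Subtype.ext ?_)).le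
  change |x ⊔ 0| ⊓ |-x ⊔ 0| = 0
  rw [abs_of_nonneg le_sup_right, abs_of_nonneg le_sup_right]
  exact sup_zero_inf_neg_sup_zero x

theorem isLatticeHomomorphism_iff_comp_inclusion (hF : IsArchimedeanLattice F)
    (hT : T.IsOrderBounded) (hX : X.IsUniformlyDense) :
    T.IsLatticeHomomorphism ↔ (T ∘ₗ X.inclusion).IsLatticeHomomorphism := by
  refine ⟨fun h x y => h x y, fun h => ?_⟩
  have key : ∀ y : E, |T (y ⊔ 0) - T y ⊔ 0| ≤ 0 := by
    refine hX.induction (IsRegulatorLipschitz.isUniformlyClosed_setOf_le hF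
      (isRegulatorLipschitz_abs.comp
        ((hT.isRegulatorLipschitz.comp (isRegulatorLipschitz_sup_const 0)).sub
          ((isRegulatorLipschitz_sup_const 0).comp hT.isRegulatorLipschitz))) 0) fun x hx => ?_
    have h1 : T (x ⊔ 0) = T x ⊔ T 0 := (h ⟨x, hx⟩ 0).1
    rw [h1, map_zero, sub_self, abs_zero]
  have hpos : ∀ y : E, T (y ⊔ 0) = T y ⊔ 0 := fun y => by
    obtain ⟨h1, h2⟩ := abs_le'.1 (key y)
    exact le_antisymm (sub_nonpos.1 h1) (sub_nonpos.1 (by rwa [neg_sub] at h2))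
  have hsup : ∀ x y : E, T (x ⊔ y) = T x ⊔ T y := fun x y => by
    have h1 : x ⊔ y = (x - y) ⊔ 0 + y := by rw [sup_add, sub_add_cancel, zero_add]
    rw [h1, map_add, hpos, sup_add, map_sub, sub_add_cancel, zero_add]
  refine fun x y => ⟨hsup x y, ?_⟩
  have h1 := congrArg T (inf_add_sup x y)
  rw [map_add, map_add, hsup, ← inf_add_sup (T x) (T y)] at h1
  exact add_right_cancel h1

theorem injective_of_comp_inclusion (hE : IsArchimedeanLattice E) (hF : IsArchimedeanLattice F)
    (hT : T.IsOrderBounded) (hmaj : X.IsMajorizing) (hX : X.IsUniformlyDense)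
    (hd : T.IsDisjointnessPreserving) (hi : Function.Injective (T ∘ₗ X.inclusion)) :
    Function.Injective T := by
  refine (injective_iff_map_eq_zero T).2 fun y hy => ?_
  -- The two parts of `y` have equal images, which are also disjoint, hence zero.
  have habs : T |y| = 0 := by
    have h1 : |T (y ⊔ 0)| ⊓ |T (-y ⊔ 0)| = 0 := hd _ _ (by
      rw [abs_of_nonneg le_sup_right, abs_of_nonneg le_sup_right]
      exact sup_zero_inf_neg_sup_zero y)
    have h2 : T (y ⊔ 0) = T (-y ⊔ 0) := by
      rw [← sub_eq_zero, ← map_sub, sup_zero_sub_neg_sup_zero, hy]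
    rw [h2, inf_idem] at h1
    have h3 : T (-y ⊔ 0) = 0 := le_antisymm ((le_abs_self _).trans h1.le)
      (neg_nonpos.1 ((neg_le_abs _).trans h1.le))
    have h4 : |y| = y ⊔ 0 + (-y ⊔ 0) := by
      simpa [posPart_def, negPart_def] using (posPart_add_negPart y).symm
    rw [h4, map_add, h2, h3, add_zero]
  have h0 : |y| ≤ 0 := by
    refine hX.nonpos_of_forall_eq_zero hE hmaj (abs_nonneg y) fun x hx hx0 hxy => ?_
    have h1 : T x = 0 := hd.map_eq_zero_of_le hF hT hx0 hxy habs
    exact congrArg Subtype.val (@hi ⟨x, hx⟩ 0 (by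
      change T x = T 0
      rw [h1, map_zero]))
  exact le_antisymm ((le_abs_self _).trans h0) (neg_nonpos.1 ((neg_le_abs _).trans h0))

theorem isOrderContinuous_iff_comp_inclusion (hE : IsArchimedeanLattice E)
    (hF : IsArchimedeanLattice F) (hT : T.IsOrderBounded) (hmaj : X.IsMajorizing)
    (hX : X.IsUniformlyDense) :
    T.IsOrderContinuous ↔ (T ∘ₗ X.inclusion).IsOrderContinuous := by
  constructor
  · rintro h Λ _ _ _ x a ⟨D, ⟨d₀, hd₀⟩, hDdir, hD0, hD⟩
    refine h Λ (fun i => (x i : E)) a ⟨Subtype.val '' D, ⟨_, d₀, hd₀, rfl⟩, ?_, ⟨?_, ?_⟩, ?_⟩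
    · rintro _ ⟨d, hd, rfl⟩ _ ⟨d', hd', rfl⟩
      obtain ⟨c, hc, h1, h2⟩ := hDdir d hd d' hd'
      exact ⟨c, ⟨c, hc, rfl⟩, h1, h2⟩
    · rintro _ ⟨d, hd, rfl⟩
      exact hD0.1 hd
    · intro z hz
      refine hX.le_of_forall_le hE hmaj z 0 fun w hw hwz => ?_
      exact hD0.2 (show (⟨w, hw⟩ : X) ∈ lowerBounds D from
        fun d hd => hwz.trans (hz ⟨d, hd, rfl⟩))
    · rintro _ ⟨d, hd, rfl⟩
      exact hD d hd
  · rintro h Λ _ _ _ y a ⟨D, ⟨d₀, hd₀⟩, hDdir, hD0, hD⟩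
    -- Each `d ∈ D` is the infimum of the elements of `X` above it, so `D'` has infimum `0` in `X`.
    let D' : Set X := {x | ∃ d ∈ D, d ≤ (x : E)}
    have hDnonneg : ∀ x ∈ D', 0 ≤ x := fun x ⟨d, hd, hdx⟩ => (hD0.1 hd).trans hdx
    have hD'dir : DirectedOn (· ≥ ·) D' := by
      rintro x ⟨d, hd, hdx⟩ x' ⟨d', hd', hdx'⟩
      obtain ⟨c, hc, h1, h2⟩ := hDdir d hd d' hd'
      exact ⟨x ⊓ x', ⟨c, hc, le_inf (h1.trans hdx) (h2.trans hdx')⟩, inf_le_left, inf_le_right⟩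
    have hD'0 : IsGLB D' 0 := by
      refine ⟨hDnonneg, fun z hz => hD0.2 (show (z : E) ∈ lowerBounds D from fun d hd => ?_)⟩
      exact hX.le_of_forall_ge hE hmaj d z fun x hx hdx =>
        hz (show (⟨x, hx⟩ : X) ∈ D' from ⟨d, hd, hdx⟩)
    obtain ⟨e, he, hde⟩ := hmaj d₀ (hD0.1 hd₀)
    have he' : (⟨e, he⟩ : X) ∈ D' := ⟨d₀, hd₀, hde⟩
    have mk : ∀ d ∈ D', |(0 : X)| ≤ d := fun d hd => by rw [abs_zero]; exact hDnonneg d hd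
    have : Nonempty (DominatedPair D') := ⟨⟨⟨e, he⟩, 0, he', mk _ he'⟩⟩
    have : IsDirectedOrder (DominatedPair D') := ⟨fun p q => by
      obtain ⟨c, hc, h1, h2⟩ := hD'dir _ p.bound_mem _ q.bound_mem
      exact ⟨⟨c, 0, hc, mk c hc⟩, h1, h2⟩⟩
    -- This net runs through every vector of `X` dominated by `D'`, so its convergence bounds `T` on
    -- a whole interval `[-d, d]` of `X` at once.
    obtain ⟨W, hW, hWdir, hW0, hWx⟩ := h (DominatedPair D') DominatedPair.vec 0
      ⟨D', ⟨_, he'⟩, hD'dir, hD'0, fun d hd => ⟨⟨d, 0, hd, mk d hd⟩, fun p hp => by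
        rw [sub_zero]; exact p.abs_vec_le.trans hp⟩⟩
    refine ⟨W, hW, hWdir, hW0, fun w hw => ?_⟩
    obtain ⟨p, hp⟩ := hWx w hw
    obtain ⟨d, x₀, ⟨c, hc, hcd⟩, hx₀⟩ := p
    have hd' : d ∈ D' := ⟨c, hc, hcd⟩
    have hd0 : (0 : E) ≤ d := hDnonneg d hd'
    -- Truncation preserves `X` and fixes `[-d, d]`; the bound on `X` thus extends to the whole
    -- interval in `E`.
    have key : ∀ z : E, |T ((z ⊓ d) ⊔ -(d : E))| ≤ w := by
      refine hX.induction (IsRegulatorLipschitz.isUniformlyClosed_setOf_le hF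
        (isRegulatorLipschitz_abs.comp (hT.isRegulatorLipschitz.comp
          ((isRegulatorLipschitz_sup_const _).comp (isRegulatorLipschitz_inf_const _)))) w)
        fun x hx => ?_
      have hxd : |((⟨x, hx⟩ : X) ⊓ d) ⊔ -d| ≤ d := by
        refine abs_le'.2 ⟨sup_le inf_le_right ?_, neg_le.1 le_sup_right⟩
        exact (neg_nonpos.2 (hDnonneg d hd')).trans (hDnonneg d hd')
      have h1 := hp ⟨d, ((⟨x, hx⟩ : X) ⊓ d) ⊔ -d, hd', hxd⟩ (le_refl d)
      rw [map_zero, sub_zero] at h1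
      exact h1
    obtain ⟨i₀, hi₀⟩ := hD c hc
    refine ⟨i₀, fun i hi => ?_⟩
    obtain ⟨h1, h2⟩ := abs_le'.1 ((hi₀ i hi).trans hcd)
    have h3 := key (y i - a)
    rwa [inf_eq_left.2 h1, sup_eq_left.2 (neg_le.1 h2), map_sub] at h3

end LinearMap

theorem mainTheorem4
    {Y Z : Type*}
    [Lattice Y] [AddCommGroup Y] [IsOrderedAddMonoid Y] [Module ℝ Y] [IsOrderedModule ℝ Y]
    [Lattice Z] [AddCommGroup Z] [IsOrderedAddMonoid Z] [Module ℝ Z] [IsOrderedModule ℝ Z]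
    (hY : IsArchimedeanLattice Y) (hZ : IsArchimedeanLattice Z)
    (T : Y →ₗ[ℝ] Z) (hT : T.IsOrderBounded)
    (X : VectorSublattice Y) (hmaj : X.IsMajorizing) (hdense : X.IsUniformlyDense) :
    (T.IsPositiveOperator ↔ (T ∘ₗ X.inclusion).IsPositiveOperator) ∧
    (T.IsOrderContinuous ↔ (T ∘ₗ X.inclusion).IsOrderContinuous) ∧
    (T.IsDisjointnessPreserving ↔ (T ∘ₗ X.inclusion).IsDisjointnessPreserving) ∧
    ((Function.Injective T ∧ T.IsDisjointnessPreserving) ↔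
      (Function.Injective (T ∘ₗ X.inclusion) ∧
        (T ∘ₗ X.inclusion).IsDisjointnessPreserving)) ∧
    (∀ S : Set OperatorProperty,
      (∀ p ∈ S, p.Holds T) ↔ (∀ p ∈ S, p.Holds (T ∘ₗ X.inclusion))) ∧
    (T.IsLatticeHomomorphism ↔ (T ∘ₗ X.inclusion).IsLatticeHomomorphism) := by
  have h1 := LinearMap.isPositiveOperator_iff_comp_inclusion hZ hT hdense
  have h2 := LinearMap.isOrderContinuous_iff_comp_inclusion hY hZ hT hmaj hdense
  have h3 := LinearMap.isDisjointnessPreserving_iff_comp_inclusion hZ hT hdense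
  have h4 : (Function.Injective T ∧ T.IsDisjointnessPreserving) ↔
      (Function.Injective (T ∘ₗ X.inclusion) ∧
        (T ∘ₗ X.inclusion).IsDisjointnessPreserving) :=
    ⟨fun h => ⟨fun _ _ hxy => Subtype.ext (h.1 hxy), h3.1 h.2⟩,
      fun h => ⟨LinearMap.injective_of_comp_inclusion hY hZ hT hmaj hdense (h3.2 h.2) h.1,
        h3.2 h.2⟩⟩
  have h5 : ∀ p : OperatorProperty, p.Holds T ↔ p.Holds (T ∘ₗ X.inclusion) := by
    rintro (_ | _ | _ | _)
    exacts [h1, h2, h3, h4]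
  exact ⟨h1, h2, h3, h4, fun S => forall₂_congr fun p _ => h5 p,
    LinearMap.isLatticeHomomorphism_iff_comp_inclusion hZ hT hdense⟩
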